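/- Let $X_1,X_2,\dots$ be independent real random variables on a probability space $(\Omega,\mathcal F,P)$ with $E(X_j)=0$ and $E(X_j^2)=1$ for all $j$, and $\sup_j E(|X_j|^3)<\infty$. For each $n\ge 1$ let $\mathbf U^{(n)}=(u^{(n)}_{k,j})_{1\le k,j\le n}$ be a random orthogonal matrix on the same probability space, distributed according to the normalized Haar measure on the orthogonal group $O(n)$ and independent of the sequence $(X_j)_{j\ge1}$. (No assumption is made on the joint law of the matrices $\mathbf U^{(n)}$ for different $n$.) Put $$S_{n,k}=\sum_{j=1}^n u^{(n)}_{k,j}X_j,\qquad k=1,\dots,n.$$ Then, with probability one, $$\sup_{x\in\mathbb R}\left|\frac1n\sum_{k=1}^n 1_{\{S_{n,k}\le x\}}-\frac1{\sqrt{2\pi}}\int_{-\infty}^x e^{-u^2/2}\,du\right|\to 0\quad\text{as } n\to\infty .$$ -/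

import Mathlib

open MeasureTheory ProbabilityTheory Filter Topology

/-- The entrywise (product) σ-algebra on real matrices, i.e. the Borel σ-algebra. -/
instance matrixMeasurableSpace (m n : ℕ) : MeasurableSpace (Matrix (Fin m) (Fin n) ℝ) :=
  inferInstanceAs (MeasurableSpace (Fin m → Fin n → ℝ))

instance matrixBorelSpace (m n : ℕ) : BorelSpace (Matrix (Fin m) (Fin n) ℝ) :=
  inferInstanceAs (BorelSpace (Fin m → Fin n → ℝ))

/-- A random element `U` of `O(n)` is uniformly (Haar) distributed: it is measurable and its law
under `P` is a Haar measure. If `P` is a probability measure, this law is the unique Haar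
probability measure on the compact group `O(n)`. -/
def IsHaarDistributed {Ω : Type*} [MeasurableSpace Ω] (P : Measure Ω) {n : ℕ}
    (U : Ω → Matrix.orthogonalGroup (Fin n) ℝ) : Prop :=
  Measurable U ∧ (P.map U).IsHaarMeasure

/-- `S_{n,k} = ∑_{j=1}^n u_{k,j} x_j`, the `k`-th coordinate of `u x`, where `x` is made of the
first `n` terms of a sequence (indexed from `0`). -/
def rowSum {n : ℕ} (u : Matrix.orthogonalGroup (Fin n) ℝ) (x : ℕ → ℝ) (k : Fin n) : ℝ :=
  ∑ j : Fin n, (u : Matrix (Fin n) (Fin n) ℝ) k j * x j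

/-- The empirical CDF `x ↦ n⁻¹ ∑_{k=1}^n 1_{s_k ≤ x}` of `n` real numbers. -/
noncomputable def empiricalCDF {n : ℕ} (s : Fin n → ℝ) (x : ℝ) : ℝ :=
  (1 / (n : ℝ)) * ∑ k : Fin n, (Set.Iic x).indicator (fun _ => (1 : ℝ)) (s k)

/-- The standard normal CDF `Φ`. -/
noncomputable def stdNormalCDF (x : ℝ) : ℝ :=
  (1 / Real.sqrt (2 * Real.pi)) * ∫ u in Set.Iic x, Real.exp (-u ^ 2 / 2)

open scoped Matrix

/-! The vector of row sums is `U y` with `y = (X_1, …, X_n)`. By independence `y` may be frozen. If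
`y ≠ 0`, right-invariance of Haar measure and transitivity on spheres show that `U y`, rescaled to
length `√n`, has the law of a standard Gaussian vector rescaled in the same way
(`measure_sphereNormalize_mulVec_mem`). Averaging over `y` keeps this comparison
(`measure_sphereNormalize_mulVec_le`).

For rescaled Gaussian vectors, Chernoff bounds make the deviation probabilities of the empirical CDF
at a point summable in `n`. Borel–Cantelli then gives almost sure convergence whatever the joint law
of the matrices.

The rescaling is undone by the factor `√(n⁻¹ ∑ X_j²)`, which tends to 1 by a strong law for the
squares (`ae_tendsto_sum_sq_div`); the third moments enter there. Convergence at rational points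
extends, by monotonicity and continuity of `Φ`, to the moving points created by this factor, and
Pólya's theorem makes it uniform. -/

/-! ### Normal and empirical distribution functions -/

lemma stdNormalCDF_eq_cdf (x : ℝ) : stdNormalCDF x = cdf (gaussianReal 0 1) x := by
  rw [cdf_eq_real, measureReal_def, gaussianReal_apply_eq_integral _ one_ne_zero,
    ENNReal.toReal_ofReal (integral_nonneg fun _ ↦ gaussianPDFReal_nonneg _ _ _), stdNormalCDF, ← integral_const_mul]
  refine integral_congr_ae (ae_of_all _ fun u ↦ ?_)
  simp [gaussianPDFReal]

lemma monotone_stdNormalCDF : Monotone stdNormalCDF := fun x y h ↦ by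
  simpa only [stdNormalCDF_eq_cdf] using monotone_cdf _ h

lemma continuous_stdNormalCDF : Continuous stdNormalCDF := by
  have h : stdNormalCDF = fun x ↦ cdf (gaussianReal 0 1) x := funext stdNormalCDF_eq_cdf
  rw [h, continuous_iff_continuousAt]
  intro x
  rw [(monotone_cdf _).continuousAt_iff_leftLim_eq_rightLim, StieltjesFunction.rightLim_eq]
  have h1 : (cdf (gaussianReal 0 1)).measure {x} = 0 := by
    rw [measure_cdf]
    have := nullSingletonClass_gaussianReal (μ := 0) (v := 1) one_ne_zero
    exact measure_singleton x
  rw [StieltjesFunction.measure_singleton, ENNReal.ofReal_eq_zero, sub_nonpos] at h1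
  exact le_antisymm ((monotone_cdf _).leftLim_le le_rfl) h1

lemma stdNormalCDF_nonneg (x : ℝ) : 0 ≤ stdNormalCDF x := by
  rw [stdNormalCDF_eq_cdf]; exact cdf_nonneg _ _

lemma stdNormalCDF_le_one (x : ℝ) : stdNormalCDF x ≤ 1 := by
  rw [stdNormalCDF_eq_cdf]; exact cdf_le_one _ _

lemma tendsto_stdNormalCDF_atTop : Tendsto stdNormalCDF atTop (𝓝 1) := by
  rw [show stdNormalCDF = fun x ↦ cdf (gaussianReal 0 1) x from funext stdNormalCDF_eq_cdf]
  exact tendsto_cdf_atTop _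

lemma tendsto_stdNormalCDF_atBot : Tendsto stdNormalCDF atBot (𝓝 0) := by
  rw [show stdNormalCDF = fun x ↦ cdf (gaussianReal 0 1) x from funext stdNormalCDF_eq_cdf]
  exact tendsto_cdf_atBot _

lemma exists_stdNormalCDF_eq {y : ℝ} (h0 : 0 < y) (h1 : y < 1) : ∃ t, stdNormalCDF t = y := by
  obtain ⟨a, ha⟩ := (tendsto_stdNormalCDF_atBot.eventually (gt_mem_nhds h0)).exists
  obtain ⟨b, hb⟩ := (tendsto_stdNormalCDF_atTop.eventually (lt_mem_nhds h1)).exists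
  exact mem_range_of_exists_le_of_exists_ge continuous_stdNormalCDF ⟨a, ha.le⟩ ⟨b, hb.le⟩

lemma monotone_empiricalCDF {n : ℕ} (s : Fin n → ℝ) : Monotone (empiricalCDF s) := by
  intro x y h
  unfold empiricalCDF
  gcongr

lemma empiricalCDF_nonneg {n : ℕ} (s : Fin n → ℝ) (x : ℝ) : 0 ≤ empiricalCDF s x := by
  unfold empiricalCDF
  exact mul_nonneg (by positivity)
    (Finset.sum_nonneg fun _ _ ↦ Set.indicator_nonneg (fun _ _ ↦ zero_le_one) _)

lemma empiricalCDF_le_one {n : ℕ} (s : Fin n → ℝ) (x : ℝ) : empiricalCDF s x ≤ 1 := by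
  unfold empiricalCDF
  have h : ∑ k : Fin n, (Set.Iic x).indicator (fun _ => (1 : ℝ)) (s k) ≤ n := by
    calc _ ≤ ∑ _k : Fin n, (1 : ℝ) := Finset.sum_le_sum fun k _ ↦
          Set.indicator_le_self' (fun _ _ ↦ zero_le_one) _
      _ = n := by simp
  rcases n.eq_zero_or_pos with rfl | hn
  · simp
  · rw [one_div, inv_mul_le_iff₀ (by positivity)]
    simpa using h

lemma empiricalCDF_const_mul {n : ℕ} (s : Fin n → ℝ) {c : ℝ} (hc : 0 < c) (x : ℝ) :
    empiricalCDF (fun k ↦ c * s k) x = empiricalCDF s (x / c) := by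
  unfold empiricalCDF
  congr 1
  refine Finset.sum_congr rfl fun k _ ↦ ?_
  simp only [Set.indicator, Set.mem_Iic, le_div_iff₀' hc]

/-! ### From pointwise to uniform convergence of monotone functions -/

/-- Monotone functions converging pointwise on a dense set to a continuous function converge along
convergent sequences of points. -/
lemma tendsto_apply_of_monotone_of_dense {F : ℕ → ℝ → ℝ} {G : ℝ → ℝ} {D : Set ℝ} (hD : Dense D)
    (hF : ∀ n, Monotone (F n)) (hG : Continuous G)
    (h : ∀ q ∈ D, Tendsto (fun n ↦ F n q) atTop (𝓝 (G q))) {t : ℕ → ℝ} {a : ℝ}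
    (ht : Tendsto t atTop (𝓝 a)) : Tendsto (fun n ↦ F n (t n)) atTop (𝓝 (G a)) := by
  rw [tendsto_order]
  constructor
  · intro y hy
    have h1 : ∀ᶠ q in 𝓝 a, y < G q := hG.continuousAt.eventually (lt_mem_nhds hy)
    obtain ⟨l, hl, hlq⟩ := exists_Ioc_subset_of_mem_nhds h1 (exists_lt a)
    obtain ⟨q, hqD, hq⟩ := hD.exists_between hl
    filter_upwards [(h q hqD).eventually (lt_mem_nhds (hlq ⟨hq.1, hq.2.le⟩)),
      ht.eventually (lt_mem_nhds hq.2)] with n hn1 hn2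
    exact hn1.trans_le (hF n hn2.le)
  · intro y hy
    have h1 : ∀ᶠ q in 𝓝 a, G q < y := hG.continuousAt.eventually (gt_mem_nhds hy)
    obtain ⟨l, hl, hlq⟩ := exists_Ico_subset_of_mem_nhds h1 (exists_gt a)
    obtain ⟨q, hqD, hq⟩ := hD.exists_between hl
    filter_upwards [(h q hqD).eventually (gt_mem_nhds (hlq ⟨hq.1.le, hq.2⟩)),
      ht.eventually (gt_mem_nhds hq.1)] with n hn1 hn2
    exact (hF n hn2.le).trans_lt hn1

/-- **Pólya's theorem** for the standard normal limit. -/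
lemma tendsto_iSup_abs_sub_stdNormalCDF {F : ℕ → ℝ → ℝ} (hF : ∀ n, Monotone (F n))
    (h0 : ∀ n x, 0 ≤ F n x) (h1 : ∀ n x, F n x ≤ 1)
    (h : ∀ x, Tendsto (fun n ↦ F n x) atTop (𝓝 (stdNormalCDF x))) :
    Tendsto (fun n ↦ ⨆ x, |F n x - stdNormalCDF x|) atTop (𝓝 0) := by
  rw [Metric.tendsto_atTop']
  intro ε hε
  -- Mesh `1 / N < ε / 4` plus an error `ε / 4` at each quantile gives `ε / 2`, leaving room for a
  -- strict inequality after the supremum.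
  obtain ⟨N, hN⟩ := exists_nat_gt (4 / ε)
  have hN0 : (0 : ℝ) < N := (by positivity : (0 : ℝ) < 4 / ε).trans hN
  have hNε : 1 / (N : ℝ) < ε / 4 := by
    rw [div_lt_iff₀ hε] at hN
    rw [div_lt_iff₀ hN0]; linarith
  have ht : ∀ j : ℕ, ∃ t, 0 < j → j < N → stdNormalCDF t = (j : ℝ) / N := by
    intro j
    by_cases hj : 0 < j ∧ j < N
    · obtain ⟨t, ht⟩ := exists_stdNormalCDF_eq (y := (j : ℝ) / N)
        (div_pos (by exact_mod_cast hj.1) hN0) ((div_lt_one hN0).2 (by exact_mod_cast hj.2))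
      exact ⟨t, fun _ _ ↦ ht⟩
    · exact ⟨0, fun a b ↦ absurd ⟨a, b⟩ hj⟩
  choose t ht using ht
  have hev : ∀ᶠ n in atTop, ∀ j ∈ Finset.range N, |F n (t j) - stdNormalCDF (t j)| < ε / 4 := by
    rw [Filter.eventually_all_finset]
    intro j _
    exact (Metric.tendsto_nhds.1 (h (t j)) (ε / 4) (by positivity))
  obtain ⟨n₀, hn₀⟩ := eventually_atTop.1 hev
  refine ⟨n₀, fun n hn ↦ ?_⟩
  have key : ∀ x, |F n x - stdNormalCDF x| ≤ ε / 2 := by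
    intro x
    have hx0 := stdNormalCDF_nonneg x
    have hx1 := stdNormalCDF_le_one x
    have hup : F n x ≤ stdNormalCDF x + ε / 2 := by
      -- First grid level strictly above `Φ(x)`. If it is at least 1 there is no quantile to use,
      -- and `F ≤ 1` suffices.
      obtain ⟨j, hj⟩ : ∃ j, j = ⌊stdNormalCDF x * N⌋₊ + 1 := ⟨_, rfl⟩
      have hlt : stdNormalCDF x * N < j := by rw [hj]; exact_mod_cast Nat.lt_floor_add_one _
      have hle : (j : ℝ) ≤ stdNormalCDF x * N + 1 := by
        rw [hj]; push_cast; gcongr; exact Nat.floor_le (by positivity)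
      have hle' : (j : ℝ) / N ≤ stdNormalCDF x + 1 / N := by
        rw [div_le_iff₀ hN0]; field_simp; linarith
      by_cases hjN : j < N
      · have htj := ht j (by omega) hjN
        have hxt : x ≤ t j := by
          by_contra! hc
          have := monotone_stdNormalCDF hc.le
          rw [htj, div_le_iff₀ hN0] at this
          linarith
        have := abs_lt.1 (hn₀ n hn.le j (Finset.mem_range.2 hjN))
        have := hF n hxt
        rw [htj] at *
        linarith
      · have : (1 : ℝ) ≤ j / N := by
          rw [le_div_iff₀ hN0, one_mul]; exact_mod_cast not_lt.1 hjN
        linarith [h1 n x]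
    have hlo : stdNormalCDF x - ε / 2 ≤ F n x := by
      -- Last grid level strictly below `Φ(x)` when `j > 0`; if `j = 0`, then `Φ(x) ≤ 1 / N` and `F
      -- ≥ 0` suffices.
      obtain ⟨j, hj⟩ : ∃ j, j = ⌈stdNormalCDF x * N⌉₊ - 1 := ⟨_, rfl⟩
      rcases Nat.eq_zero_or_pos j with h | hjpos
      · have : (⌈stdNormalCDF x * N⌉₊ : ℝ) ≤ 1 := by
          have : ⌈stdNormalCDF x * N⌉₊ ≤ 1 := by omega
          exact_mod_cast this
        have h2 : stdNormalCDF x ≤ 1 / N := by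
          rw [le_div_iff₀ hN0]; exact (Nat.le_ceil _).trans this
        linarith [h0 n x]
      · have hj' : ⌈stdNormalCDF x * N⌉₊ = j + 1 := by omega
        have hge : stdNormalCDF x * N ≤ j + 1 := by
          have := Nat.le_ceil (stdNormalCDF x * N)
          rw [hj'] at this; exact_mod_cast this
        have hlt : (j : ℝ) < stdNormalCDF x * N := by
          apply Nat.lt_ceil.1; omega
        have hjN : j < N := by
          have : (j : ℝ) < N := by nlinarith
          exact_mod_cast this
        have hle' : stdNormalCDF x ≤ (j : ℝ) / N + 1 / N := by
          rw [← add_div, le_div_iff₀ hN0]; exact hge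
        have htj := ht j hjpos hjN
        have hxt : t j ≤ x := by
          by_contra! hc
          have := monotone_stdNormalCDF hc.le
          rw [htj, le_div_iff₀ hN0] at this
          linarith
        have := abs_lt.1 (hn₀ n hn.le j (Finset.mem_range.2 hjN))
        have := hF n hxt
        rw [htj] at *
        linarith
    rw [abs_le]; constructor <;> linarith
  rw [Real.dist_0_eq_abs, abs_of_nonneg (Real.iSup_nonneg fun _ ↦ abs_nonneg _)]
  exact (ciSup_le key).trans_lt (by linarith)

/-! ### Exponential tail bounds for product measures -/

/-- **Chernoff bound** for sums of i.i.d. variables, with an exponential rate. -/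
lemma exists_pi_measure_sum_ge_le_pow {μ : Measure ℝ} [IsProbabilityMeasure μ] {f : ℝ → ℝ}
    (h0 : 0 ∈ interior (integrableExpSet f μ)) {c : ℝ} (hc : ∫ x, f x ∂μ < c) :
    ∃ ρ : ℝ, 0 ≤ ρ ∧ ρ < 1 ∧ ∀ n : ℕ,
      (Measure.pi fun _ : Fin n ↦ μ).real {g | n * c ≤ ∑ i, f (g i)} ≤ ρ ^ n := by
  obtain ⟨s, hs0, hsint, hs⟩ : ∃ s, 0 < s ∧ s ∈ integrableExpSet f μ ∧
      Real.exp (-s * c) * mgf f μ s < 1 := by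
    -- The function equals 1 at 0 and has negative derivative `E f - c` there, so it is below 1 for
    -- small `s > 0`; its value at such an `s` is the rate `ρ`.
    have hd : HasDerivAt (fun s ↦ Real.exp (-s * c) * mgf f μ s) (-c + ∫ x, f x ∂μ) 0 := by
      have h1 : HasDerivAt (mgf f μ) (∫ x, f x ∂μ) 0 := by
        simpa using hasDerivAt_mgf h0
      have h2 : HasDerivAt (fun s : ℝ ↦ Real.exp (-s * c)) (-c) 0 := by
        simpa using ((hasDerivAt_id (0 : ℝ)).neg.mul_const c).exp
      simpa using! h2.mul h1
    have hneg : -c + ∫ x, f x ∂μ < 0 := by linarith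
    have h2 : ∀ᶠ s in 𝓝[>] (0 : ℝ), Real.exp (-s * c) * mgf f μ s < 1 := by
      have := (hasDerivAt_iff_tendsto_slope.1 hd).eventually (gt_mem_nhds hneg)
      have := this.filter_mono (nhdsWithin_mono 0 (fun x (hx : 0 < x) ↦ hx.ne' : Set.Ioi (0:ℝ) ⊆ {0}ᶜ))
      filter_upwards [this, self_mem_nhdsWithin] with s hs hs0
      have hs0 : 0 < s := hs0
      rw [slope_def_field, div_lt_iff₀ (by simpa using hs0)] at hs
      simp at hs
      simpa using hs
    have h3 : ∀ᶠ s in 𝓝[>] (0 : ℝ), s ∈ integrableExpSet f μ :=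
      mem_nhdsWithin_of_mem_nhds (mem_interior_iff_mem_nhds.1 h0)
    obtain ⟨s, a, b, d⟩ := (h2.and (h3.and self_mem_nhdsWithin)).exists
    exact ⟨s, d, b, a⟩
  refine ⟨_, mul_nonneg (Real.exp_pos _).le mgf_nonneg, hs, fun n ↦ ?_⟩
  set π := (Measure.pi fun _ : Fin n ↦ μ)
  have hexp : (fun g : Fin n → ℝ ↦ Real.exp (s * ∑ i, f (g i)))
      = fun g ↦ ∏ i, Real.exp (s * f (g i)) := by
    ext g; rw [Finset.mul_sum, Real.exp_sum]
  have hint : Integrable (fun g : Fin n → ℝ ↦ Real.exp (s * ∑ i, f (g i))) π := by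
    rw [hexp]
    exact Integrable.fintype_prod (f := fun _ x ↦ Real.exp (s * f x)) fun _ ↦ hsint
  have hm : mgf (fun g : Fin n → ℝ ↦ ∑ i, f (g i)) π s = mgf f μ s ^ n := by
    unfold mgf
    rw [hexp, integral_fintype_prod_eq_pow (f := fun x ↦ Real.exp (s * f x))]
    simp
  refine (measure_ge_le_exp_mul_mgf (n * c) hs0.le hint).trans_eq ?_
  rw [hm, mul_pow, ← Real.exp_nat_mul]
  ring_nf

/-! ### Haar measure, rotations and Gaussian vectors -/

instance secondCountableTopology_orthogonalGroup (n : ℕ) :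
    SecondCountableTopology (Matrix.orthogonalGroup (Fin n) ℝ) :=
  haveI : SecondCountableTopology (Matrix (Fin n) (Fin n) ℝ) :=
    inferInstanceAs (SecondCountableTopology (Fin n → Fin n → ℝ))
  TopologicalSpace.Subtype.secondCountableTopology _

/-- A left-invariant probability measure on a group is inversion-invariant. -/
lemma map_inv_eq_self_of_isMulLeftInvariant {G : Type*} [Group G] [MeasurableSpace G]
    [MeasurableMul₂ G] [MeasurableInv G] (μ : Measure G) [IsProbabilityMeasure μ]
    [μ.IsMulLeftInvariant] : μ.map (·⁻¹) = μ := by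
  ext A hA
  rw [Measure.map_apply measurable_inv hA]
  -- Fubini on this set: fixing the first coordinate gives a left translate of `A`, fixing the
  -- second a left translate of the inverse of `A`.
  have hm : MeasurableSet {p : G × G | p.1⁻¹ * p.2 ∈ A} :=
    (measurable_fst.inv.mul measurable_snd) hA
  have h1 : (μ.prod μ) {p : G × G | p.1⁻¹ * p.2 ∈ A} = μ A := by
    rw [Measure.prod_apply hm]
    have : ∀ w : G, μ (Prod.mk w ⁻¹' {p : G × G | p.1⁻¹ * p.2 ∈ A}) = μ A := fun w ↦
      measure_preimage_mul μ w⁻¹ A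
    simp_rw [this]
    simp
  have h2 : (μ.prod μ) {p : G × G | p.1⁻¹ * p.2 ∈ A} = μ ((·⁻¹) ⁻¹' A) := by
    rw [Measure.prod_apply_symm hm]
    have : ∀ u : G, μ ((fun w ↦ (w, u)) ⁻¹' {p : G × G | p.1⁻¹ * p.2 ∈ A})
        = μ ((·⁻¹) ⁻¹' A) := fun u ↦ by
      rw [← measure_preimage_mul μ u⁻¹ ((·⁻¹) ⁻¹' A)]
      congr 1
      ext w
      simp
    simp_rw [this]
    simp
  rw [← h2, h1]

/-- Inversion preserves `μ` and exchanges right translations with left translations. -/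
lemma measure_preimage_mul_right_of_isMulLeftInvariant {G : Type*} [Group G] [MeasurableSpace G]
    [MeasurableMul₂ G] [MeasurableInv G] (μ : Measure G) [IsProbabilityMeasure μ]
    [μ.IsMulLeftInvariant] (g : G) {A : Set G} (hA : MeasurableSet A) :
    μ ((· * g) ⁻¹' A) = μ A := by
  have hA' := (measurable_mul_const g) hA
  conv_lhs => rw [← map_inv_eq_self_of_isMulLeftInvariant μ, Measure.map_apply measurable_inv hA']
  conv_rhs => rw [← map_inv_eq_self_of_isMulLeftInvariant μ, Measure.map_apply measurable_inv hA,
    ← measure_preimage_mul μ g⁻¹]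
  congr 1
  ext w
  simp

lemma sum_sq_mulVec {n : ℕ} (V : Matrix.orthogonalGroup (Fin n) ℝ) (y : Fin n → ℝ) :
    ∑ k, ((V : Matrix (Fin n) (Fin n) ℝ) *ᵥ y) k ^ 2 = ∑ k, y k ^ 2 := by
  have h : ∀ z : Fin n → ℝ, ∑ k, z k ^ 2 = z ⬝ᵥ z := fun z ↦ by simp [dotProduct, sq]
  rw [h, h, Matrix.dotProduct_mulVec, Matrix.vecMul_mulVec,
    show (V : Matrix (Fin n) (Fin n) ℝ)ᵀ * V = 1 from Matrix.UnitaryGroup.star_mul_self V]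
  simp

/-- The orthogonal group acts transitively on spheres. -/
lemma exists_orthogonalGroup_mulVec_eq {n : ℕ} {y z : Fin n → ℝ}
    (h : ∑ k, y k ^ 2 = ∑ k, z k ^ 2) :
    ∃ V : Matrix.orthogonalGroup (Fin n) ℝ, (V : Matrix (Fin n) (Fin n) ℝ) *ᵥ y = z := by
  let b := EuclideanSpace.basisFun (Fin n) ℝ
  have hn : ‖WithLp.toLp 2 y‖ = ‖WithLp.toLp 2 z‖ := by
    simp [EuclideanSpace.norm_eq, h]
  -- Householder reflection: for vectors of equal length, the reflection in the hyperplane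
  -- orthogonal to `y - z` exchanges them; for `y = z` it is the identity.
  let R := (ℝ ∙ (WithLp.toLp 2 y - WithLp.toLp 2 z))ᗮ.reflection
  refine ⟨⟨_, R.toMatrix_mem_unitaryGroup b b⟩, ?_⟩
  have h1 := LinearMap.toMatrix_mulVec_repr b.toBasis b.toBasis
    (R.toLinearEquiv : EuclideanSpace ℝ (Fin n) →ₗ[ℝ] EuclideanSpace ℝ (Fin n)) (WithLp.toLp 2 y)
  have h2 : R (WithLp.toLp 2 y) = WithLp.toLp 2 z := Submodule.reflection_sub hn
  ext k
  have h3 := congrFun h1 k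
  simp only [b] at h3
  simpa [h2] using! h3

/-- The product Gaussian is the standard Gaussian of Euclidean space, which every linear isometry
preserves. -/
lemma map_mulVec_pi_gaussianReal {n : ℕ} (V : Matrix.orthogonalGroup (Fin n) ℝ) :
    (Measure.pi fun _ : Fin n ↦ gaussianReal 0 1).map ((V : Matrix (Fin n) (Fin n) ℝ) *ᵥ ·) =
      Measure.pi fun _ : Fin n ↦ gaussianReal 0 1 := by
  let f : EuclideanSpace ℝ (Fin n) ≃ₗᵢ[ℝ] EuclideanSpace ℝ (Fin n) :=
    { toLinearEquiv := (WithLp.linearEquiv 2 ℝ (Fin n → ℝ)).trans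
        ((Matrix.UnitaryGroup.toLinearEquiv V).trans (WithLp.linearEquiv 2 ℝ (Fin n → ℝ)).symm)
      norm_map' := fun x ↦ by
        rw [EuclideanSpace.norm_eq, EuclideanSpace.norm_eq]
        simp only [Real.norm_eq_abs, sq_abs]
        exact congrArg Real.sqrt (sum_sq_mulVec V x.ofLp) }
  have hf : ∀ x : EuclideanSpace ℝ (Fin n), (f x).ofLp = (V : Matrix (Fin n) (Fin n) ℝ) *ᵥ x.ofLp :=
    fun x ↦ rfl
  have h := stdGaussian_map f
  rw [← map_pi_eq_stdGaussian, Measure.map_map (by fun_prop) (by fun_prop)] at h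
  have h' := congrArg (Measure.map (WithLp.ofLp (p := 2) (V := Fin n → ℝ))) h
  rw [Measure.map_map (by fun_prop) (by fun_prop), Measure.map_map (by fun_prop) (by fun_prop)] at h'
  simpa [Function.comp_def, hf] using h'

/-! ### The law of a rotated vector on the sphere of radius `√n` -/

/-- Rescaling of a nonzero vector of `ℝⁿ` to Euclidean length `√n`. -/
noncomputable def sphereNormalize {n : ℕ} (y : Fin n → ℝ) : Fin n → ℝ :=
  fun k ↦ √n / √(∑ j, y j ^ 2) * y k

lemma measurable_sphereNormalize {n : ℕ} : Measurable (sphereNormalize (n := n)) := by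
  unfold sphereNormalize
  refine measurable_pi_lambda _ fun k ↦ ?_
  fun_prop

lemma sum_sq_sphereNormalize {n : ℕ} {y : Fin n → ℝ} (hy : y ≠ 0) :
    ∑ k, sphereNormalize y k ^ 2 = n := by
  have h : 0 < ∑ j, y j ^ 2 := by
    obtain ⟨k, hk⟩ := Function.ne_iff.1 hy
    exact Finset.sum_pos' (fun _ _ ↦ sq_nonneg _) ⟨k, Finset.mem_univ k, sq_pos_of_ne_zero hk⟩
  simp only [sphereNormalize, mul_pow, ← Finset.mul_sum, div_pow]
  rw [Real.sq_sqrt (by positivity), Real.sq_sqrt h.le, div_mul_cancel₀ _ h.ne']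

lemma sphereNormalize_mulVec {n : ℕ} (V : Matrix.orthogonalGroup (Fin n) ℝ) (y : Fin n → ℝ) :
    sphereNormalize ((V : Matrix (Fin n) (Fin n) ℝ) *ᵥ y) =
      (V : Matrix (Fin n) (Fin n) ℝ) *ᵥ sphereNormalize y := by
  have h : sphereNormalize y = (√n / √(∑ j, y j ^ 2)) • y := rfl
  rw [h, Matrix.mulVec_smul]
  ext k
  simp only [sphereNormalize, sum_sq_mulVec]
  rfl

lemma measurable_mulVec_orthogonalGroup {n : ℕ} :
    Measurable fun p : Matrix.orthogonalGroup (Fin n) ℝ × (Fin n → ℝ) ↦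
      (p.1 : Matrix (Fin n) (Fin n) ℝ) *ᵥ p.2 := by
  refine Continuous.measurable ?_
  fun_prop

/-- If the sections of a measurable set have almost surely constant measures in each variable, then
these constants agree. -/
lemma eq_of_ae_measure_section_eq {α β : Type*} [MeasurableSpace α] [MeasurableSpace β]
    {μ : Measure α} {ν : Measure β} [IsProbabilityMeasure μ] [IsProbabilityMeasure ν]
    {S : Set (α × β)} (hS : MeasurableSet S) {a b : ENNReal}
    (ha : ∀ᵐ x ∂μ, ν {y | (x, y) ∈ S} = a) (hb : ∀ᵐ y ∂ν, μ {x | (x, y) ∈ S} = b) : a = b := by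
  have h1 : (μ.prod ν) S = a := by
    rw [Measure.prod_apply hS]
    exact (lintegral_congr_ae ha).trans (by simp)
  have h2 : (μ.prod ν) S = b := by
    rw [Measure.prod_apply_symm hS]
    exact (lintegral_congr_ae hb).trans (by simp)
  rw [← h1, h2]

/-- The index `k` excludes `n = 0`, where every vector vanishes; a single coordinate is already
almost surely nonzero. -/
lemma ae_pi_gaussianReal_ne_zero {n : ℕ} (k : Fin n) :
    ∀ᵐ g ∂(Measure.pi fun _ : Fin n ↦ gaussianReal 0 1), g ≠ 0 := by
  have hna := nullSingletonClass_gaussianReal (μ := 0) (v := 1) one_ne_zero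
  have hk : ∀ᵐ t ∂(gaussianReal 0 1), t ≠ 0 := by
    rw [ae_iff]
    simp
  have := (Measure.quasiMeasurePreserving_eval (μ := fun _ : Fin n ↦ gaussianReal 0 1) k).ae hk
  filter_upwards [this] with g hg hg0
  exact hg (by simp [hg0])

lemma measurable_sphereNormalize_mulVec {n : ℕ} (y : Fin n → ℝ) :
    Measurable fun u : Matrix.orthogonalGroup (Fin n) ℝ ↦
      sphereNormalize ((u : Matrix (Fin n) (Fin n) ℝ) *ᵥ y) :=
  measurable_sphereNormalize.comp (measurable_mulVec_orthogonalGroup.comp measurable_prodMk_right)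

/-- The law of a normalized rotated vector does not depend on the vector. -/
lemma measure_sphereNormalize_mulVec_mem_eq {n : ℕ}
    (μ : Measure (Matrix.orthogonalGroup (Fin n) ℝ))
    [IsProbabilityMeasure μ] [μ.IsMulLeftInvariant] {y z : Fin n → ℝ} (hy : y ≠ 0) (hz : z ≠ 0)
    {A : Set (Fin n → ℝ)} (hA : MeasurableSet A) :
    μ {u | sphereNormalize ((u : Matrix (Fin n) (Fin n) ℝ) *ᵥ y) ∈ A} =
      μ {u | sphereNormalize ((u : Matrix (Fin n) (Fin n) ℝ) *ᵥ z) ∈ A} := by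
  obtain ⟨V, hV⟩ := exists_orthogonalGroup_mulVec_eq
    ((sum_sq_sphereNormalize hz).trans (sum_sq_sphereNormalize hy).symm)
  have h := measure_preimage_mul_right_of_isMulLeftInvariant μ V
    (measurable_sphereNormalize_mulVec z hA)
  refine Eq.trans (congrArg μ ?_) h
  ext u
  simp only [Set.mem_ofPred_eq, Set.mem_preimage, sphereNormalize_mulVec, ← hV,
    Matrix.mulVec_mulVec, Submonoid.coe_mul]

/-- The image of a fixed nonzero vector under a Haar distributed rotation is distributed, after
normalization, as a normalized Gaussian vector. -/
lemma measure_sphereNormalize_mulVec_mem {n : ℕ}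
    (μ : Measure (Matrix.orthogonalGroup (Fin n) ℝ))
    [IsProbabilityMeasure μ] [μ.IsMulLeftInvariant] {y : Fin n → ℝ} (hy : y ≠ 0)
    {A : Set (Fin n → ℝ)} (hA : MeasurableSet A) :
    μ {u | sphereNormalize ((u : Matrix (Fin n) (Fin n) ℝ) *ᵥ y) ∈ A} =
      (Measure.pi fun _ : Fin n ↦ gaussianReal 0 1) {g | sphereNormalize g ∈ A} := by
  obtain ⟨k, -⟩ := Function.ne_iff.1 hy
  symm
  -- Apply a Haar rotation `u` to a Gaussian `g`. For fixed `u`, Gaussian invariance removes `u`;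
  -- for fixed `g ≠ 0`, transitivity replaces `g` by `y`.
  refine eq_of_ae_measure_section_eq (μ := μ)
    (ν := Measure.pi fun _ : Fin n ↦ gaussianReal 0 1)
    ((measurable_sphereNormalize.comp measurable_mulVec_orthogonalGroup) hA)
    (ae_of_all _ fun u ↦ ?_) ?_
  · have hu : Measurable ((u : Matrix (Fin n) (Fin n) ℝ) *ᵥ ·) :=
      measurable_mulVec_orthogonalGroup.comp measurable_prodMk_left
    have h := Measure.map_apply (μ := Measure.pi fun _ : Fin n ↦ gaussianReal 0 1) hu
      (measurable_sphereNormalize hA)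
    rw [map_mulVec_pi_gaussianReal u] at h
    exact h.symm
  · filter_upwards [ae_pi_gaussianReal_ne_zero k] with g hg
    exact measure_sphereNormalize_mulVec_mem_eq μ hg hy hA

/-! ### Strong law for the squares, by truncation -/

/-- Borel–Cantelli along the countable family of thresholds `1 / (m + 1)`; no joint law of the `Z n`
is involved. -/
lemma ae_tendsto_of_tsum_measure_ne_top {Ω : Type*} [MeasurableSpace Ω] {P : Measure Ω}
    {Z : ℕ → Ω → ℝ} {l : ℝ} (h : ∀ ε > 0, ∑' n, P {ω | ε ≤ |Z n ω - l|} ≠ ⊤) :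
    ∀ᵐ ω ∂P, Tendsto (fun n ↦ Z n ω) atTop (𝓝 l) := by
  have h' : ∀ᵐ ω ∂P, ∀ m : ℕ, ∀ᶠ n in atTop, ω ∉ {ω | 1 / ((m : ℝ) + 1) ≤ |Z n ω - l|} :=
    ae_all_iff.2 fun m ↦ ae_eventually_notMem (h _ (by positivity))
  filter_upwards [h'] with ω hω
  rw [Metric.tendsto_nhds]
  intro ε hε
  obtain ⟨m, hm⟩ := exists_nat_one_div_lt hε
  filter_upwards [hω m] with n hn
  exact (not_le.1 hn).trans hm

/-- Truncation of `t` at level `c`. -/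
noncomputable def truncateAbove (c t : ℝ) : ℝ := (Set.Iic c).indicator id t

lemma measurable_truncateAbove (c : ℝ) : Measurable (truncateAbove c) :=
  measurable_id.indicator measurableSet_Iic

lemma truncateAbove_nonneg (c : ℝ) {t : ℝ} (ht : 0 ≤ t) : 0 ≤ truncateAbove c t :=
  Set.indicator_apply_nonneg fun _ ↦ ht

lemma truncateAbove_le_self (c : ℝ) {t : ℝ} (ht : 0 ≤ t) : truncateAbove c t ≤ t :=
  Set.indicator_apply_le' (fun _ ↦ le_rfl) fun _ ↦ ht

/-- Bounds the variance of a truncated square by a third moment, since no fourth moment is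
available. -/
lemma truncateAbove_sq_sq_le {c : ℝ} (x : ℝ) :
    truncateAbove (c ^ 2) (x ^ 2) ^ 2 ≤ |c| * |x| ^ 3 := by
  unfold truncateAbove Set.indicator
  split_ifs with h
  · have h1 : |x| ≤ |c| := sq_le_sq.1 h
    calc id (x ^ 2) ^ 2 = |x| * |x| ^ 3 := by
          simp only [id, ← sq_abs x]; ring
      _ ≤ |c| * |x| ^ 3 := by gcongr
  · simp; positivity

/-- Bounds the mean lost by truncation, again by a third moment. -/
lemma sq_sub_truncateAbove_le {c : ℝ} (hc : 0 < c) (x : ℝ) :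
    x ^ 2 - truncateAbove (c ^ 2) (x ^ 2) ≤ |x| ^ 3 / c := by
  unfold truncateAbove Set.indicator
  split_ifs with h
  · simp; positivity
  · have h1 : c < |x| := by
      have := sq_lt_sq.1 (not_le.1 (mt Set.mem_Iic.2 h)); rwa [abs_of_pos hc] at this
    rw [le_div_iff₀ hc, sub_zero, ← sq_abs]
    calc |x| ^ 2 * c ≤ |x| ^ 2 * |x| := by gcongr
      _ = |x| ^ 3 := by ring

/-- By Markov's inequality for third moments, `|X j| ≥ √(j + 1)` has probability at most `B (j +
1)^(-3/2)`, which is summable. -/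
lemma ae_eventually_truncateAbove_eq {Ω : Type*} [MeasurableSpace Ω] {P : Measure Ω}
    [IsProbabilityMeasure P] {X : ℕ → Ω → ℝ} {B : ℝ}
    (hint : ∀ j, Integrable (fun ω ↦ |X j ω| ^ 3) P) (hB : ∀ j, ∫ ω, |X j ω| ^ 3 ∂P ≤ B) :
    ∀ᵐ ω ∂P, ∀ᶠ j : ℕ in atTop,
      truncateAbove (√((j : ℝ) + 1) ^ 2) (X j ω ^ 2) = X j ω ^ 2 := by
  have hs : ∑' j : ℕ, P {ω | √((j : ℝ) + 1) ^ 3 ≤ |X j ω| ^ 3} ≠ ⊤ := by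
    have hb : ∀ j : ℕ, P {ω | √((j : ℝ) + 1) ^ 3 ≤ |X j ω| ^ 3} ≤
        ENNReal.ofReal (B * (1 / ((j + 1 : ℕ) : ℝ) ^ (3 / 2 : ℝ))) := by
      intro j
      have h0 : (0 : ℝ) < (j : ℝ) + 1 := by positivity
      have h1 := mul_meas_ge_le_integral_of_nonneg (ae_of_all P fun ω ↦ by positivity)
        (hint j) (√((j : ℝ) + 1) ^ 3)
      rw [← ofReal_measureReal]
      refine ENNReal.ofReal_le_ofReal ?_
      have h2 : √((j : ℝ) + 1) ^ 3 = ((j + 1 : ℕ) : ℝ) ^ (3 / 2 : ℝ) := by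
        rw [Real.sqrt_eq_rpow, ← Real.rpow_natCast, ← Real.rpow_mul h0.le]
        norm_num
      rw [← h2, mul_one_div, le_div_iff₀ (by positivity), mul_comm]
      exact h1.trans (hB j)
    refine ne_top_of_le_ne_top ?_ (ENNReal.tsum_le_tsum hb)
    have := (summable_nat_add_iff 1).2 (Real.summable_one_div_nat_rpow.2 (by norm_num : (1 : ℝ) < 3 / 2))
    exact (this.mul_left B).tsum_ofReal_ne_top
  filter_upwards [ae_eventually_notMem hs] with ω hω
  filter_upwards [hω] with j hj
  have h1 : |X j ω| < √((j : ℝ) + 1) := lt_of_pow_lt_pow_left₀ 3 (by positivity) (not_le.1 hj)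
  refine Set.indicator_of_mem ?_ _
  rw [Set.mem_Iic, ← sq_abs]
  gcongr

/-- Strong law of large numbers for the squares of independent variables with unit variance and
bounded third absolute moments. -/
lemma ae_tendsto_sum_sq_div {Ω : Type*} [MeasurableSpace Ω] {P : Measure Ω}
    [IsProbabilityMeasure P] {X : ℕ → Ω → ℝ} {B : ℝ}
    (hX : ∀ j, Measurable (X j)) (hindep : iIndepFun X P) (hvar : ∀ j, ∫ ω, X j ω ^ 2 ∂P = 1)
    (hint : ∀ j, Integrable (fun ω ↦ |X j ω| ^ 3) P) (hB : ∀ j, ∫ ω, |X j ω| ^ 3 ∂P ≤ B) :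
    ∀ᵐ ω ∂P, Tendsto (fun n : ℕ ↦ (∑ j ∈ Finset.range n, X j ω ^ 2) / n) atTop (𝓝 1) := by
  have hB0 : 0 ≤ B := (integral_nonneg fun ω ↦ by positivity).trans (hB 0)
  let W : ℕ → Ω → ℝ := fun j ω ↦ truncateAbove (√((j : ℝ) + 1) ^ 2) (X j ω ^ 2)
  have hc0 : ∀ j : ℕ, 0 < √((j : ℝ) + 1) := fun j ↦ by positivity
  have hWm : ∀ j, Measurable (W j) := fun j ↦
    (measurable_truncateAbove _).comp ((hX j).pow_const 2)
  have hW0 : ∀ j ω, 0 ≤ W j ω := fun j ω ↦ truncateAbove_nonneg _ (sq_nonneg _)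
  have hW2 : ∀ j, MemLp (W j) 2 P := fun j ↦ by
    rw [memLp_two_iff_integrable_sq (hWm j).aestronglyMeasurable]
    refine ((hint j).const_mul |√((j : ℝ) + 1)|).mono' ((hWm j).pow_const 2).aestronglyMeasurable
      (ae_of_all _ fun ω ↦ ?_)
    rw [Real.norm_of_nonneg (sq_nonneg _)]
    exact truncateAbove_sq_sq_le _
  have hWvar : ∀ j, variance (W j) P ≤ √((j : ℝ) + 1) * B := fun j ↦ by
    refine (variance_le_expectation_sq (hWm j).aestronglyMeasurable).trans ?_
    calc P[W j ^ 2] ≤ ∫ ω, |√((j : ℝ) + 1)| * |X j ω| ^ 3 ∂P :=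
          integral_mono (f := W j ^ 2) (hW2 j).integrable_sq ((hint j).const_mul _)
            fun ω ↦ truncateAbove_sq_sq_le _
      _ = √((j : ℝ) + 1) * ∫ ω, |X j ω| ^ 3 ∂P := by
          rw [integral_const_mul, abs_of_pos (hc0 j)]
      _ ≤ _ := by gcongr; exact hB j
  -- A non-integrable function would have integral 0, not 1.
  have hXsq : ∀ j, Integrable (fun ω ↦ X j ω ^ 2) P := fun j ↦ by
    by_contra hc
    have := hvar j
    rw [integral_undef hc] at this
    exact zero_ne_one this
  have hWint : ∀ j, Integrable (W j) P := fun j ↦ (hW2 j).integrable (by norm_num)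
  have hWmean : Tendsto (fun j ↦ P[W j]) atTop (𝓝 1) := by
    have hlow : ∀ j : ℕ, 1 - B / √((j : ℝ) + 1) ≤ P[W j] := fun j ↦ by
      have h1 : ∫ ω, (X j ω ^ 2 - W j ω) ∂P ≤ ∫ ω, |X j ω| ^ 3 / √((j : ℝ) + 1) ∂P :=
        integral_mono ((hXsq j).sub (hWint j)) ((hint j).div_const _)
          fun ω ↦ sq_sub_truncateAbove_le (hc0 j) _
      rw [integral_sub (hXsq j) (hWint j), hvar, integral_div] at h1
      have h2 : (∫ ω, |X j ω| ^ 3 ∂P) / √((j : ℝ) + 1) ≤ B / √((j : ℝ) + 1) := by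
        gcongr; exact hB j
      linarith
    have hup : ∀ j, P[W j] ≤ 1 := fun j ↦ by
      rw [← hvar j]
      exact integral_mono (hWint j) (hXsq j) fun ω ↦ truncateAbove_le_self _ (sq_nonneg _)
    refine tendsto_of_tendsto_of_tendsto_of_le_of_le ?_ tendsto_const_nhds hlow hup
    have h1 : Tendsto (fun j : ℕ ↦ √((j : ℝ) + 1)) atTop atTop :=
      Real.tendsto_sqrt_atTop.comp (tendsto_atTop_add_const_right _ _ tendsto_natCast_atTop_atTop)
    simpa using (h1.const_div_atTop B).const_sub 1
  -- Along `n = k ^ 4` the variance of the sum is at most `k ^ 6 * B`, so Chebyshev gives the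
  -- summable bound `B / (ε ^ 2 * k ^ 2)`, while consecutive indices still have ratio tending to 1.
  have hpow : Tendsto (fun k : ℕ ↦ k ^ 4) atTop atTop := tendsto_pow_atTop (by norm_num)
  have hsub : ∀ᵐ ω ∂P, Tendsto (fun k : ℕ ↦
      ((∑ j ∈ Finset.range (k ^ 4), W j ω) - ∑ j ∈ Finset.range (k ^ 4), P[W j]) /
        ((k ^ 4 : ℕ) : ℝ)) atTop (𝓝 0) := by
    refine ae_tendsto_of_tsum_measure_ne_top fun ε hε ↦ ?_
    have hb : ∀ k : ℕ, P {ω | ε ≤ |((∑ j ∈ Finset.range (k ^ 4), W j ω) -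
        ∑ j ∈ Finset.range (k ^ 4), P[W j]) / ((k ^ 4 : ℕ) : ℝ) - 0|} ≤
        ENNReal.ofReal (B / ε ^ 2 * (1 / (k : ℝ) ^ 2)) := by
      intro k
      rcases k.eq_zero_or_pos with rfl | hk
      · simp [not_le.2 hε]
      have hk0 : (0 : ℝ) < k := by exact_mod_cast hk
      have hmem : MemLp (∑ j ∈ Finset.range (k ^ 4), W j) 2 P :=
        memLp_finsetSum' _ fun j _ ↦ hW2 j
      have hmean : P[∑ j ∈ Finset.range (k ^ 4), W j] = ∑ j ∈ Finset.range (k ^ 4), P[W j] := by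
        simp only [Finset.sum_apply]
        exact integral_finsetSum _ fun j _ ↦ hWint j
      have hcheb := meas_ge_le_variance_div_sq hmem (c := ε * (k : ℝ) ^ 4) (by positivity)
      rw [hmean] at hcheb
      refine (measure_mono fun ω hω ↦ ?_).trans (hcheb.trans (ENNReal.ofReal_le_ofReal ?_))
      · simp only [Set.mem_ofPred_eq, sub_zero, Nat.cast_pow, abs_div,
          abs_of_pos (pow_pos hk0 4), Finset.sum_apply] at hω ⊢
        rwa [le_div_iff₀ (by positivity)] at hω
      · have hv : variance (∑ j ∈ Finset.range (k ^ 4), W j) P ≤ k ^ 4 * (k ^ 2 * B) := by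
          rw [IndepFun.variance_sum (fun j _ ↦ hW2 j) fun i _ j _ hij ↦
            (hindep.indepFun hij).comp ((measurable_truncateAbove _).comp (measurable_id.pow_const 2))
              ((measurable_truncateAbove _).comp (measurable_id.pow_const 2))]
          calc _ ≤ ∑ j ∈ Finset.range (k ^ 4), (k : ℝ) ^ 2 * B := by
                refine Finset.sum_le_sum fun j hj ↦ (hWvar j).trans ?_
                gcongr
                rw [Real.sqrt_le_left (by positivity)]
                have : ((j + 1 : ℕ) : ℝ) ≤ ((k ^ 4 : ℕ) : ℝ) := by
                  exact_mod_cast Finset.mem_range.1 hj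
                push_cast at this
                linarith [show ((k : ℝ) ^ 2) ^ 2 = (k : ℝ) ^ 4 by ring]
            _ = _ := by simp
        rw [div_le_iff₀ (by positivity)]
        refine hv.trans_eq ?_
        field_simp
    refine ne_top_of_le_ne_top ?_ (ENNReal.tsum_le_tsum hb)
    exact ((Real.summable_one_div_nat_pow.2 one_lt_two).mul_left _).tsum_ofReal_ne_top
  have hW : ∀ᵐ ω ∂P, Tendsto (fun n : ℕ ↦ (∑ j ∈ Finset.range n, W j ω) / n) atTop (𝓝 1) := by
    filter_upwards [hsub] with ω hω
    -- Partial sums of the nonnegative `W j` are monotone, which fills the gaps between fourth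
    -- powers.
    refine tendsto_div_of_monotone_of_exists_subseq_tendsto_div _ _
      (fun m n h ↦ Finset.sum_le_sum_of_subset_of_nonneg (Finset.range_mono h)
        fun j _ _ ↦ hW0 j ω) fun a ha ↦ ⟨fun k ↦ k ^ 4, ?_, hpow, ?_⟩
    · have h1 : Tendsto (fun k : ℕ ↦ (1 + 1 / (k : ℝ)) ^ 4) atTop (𝓝 1) := by
        simpa using (tendsto_one_div_atTop_nhds_zero_nat.const_add (1 : ℝ)).pow 4
      filter_upwards [h1.eventually (gt_mem_nhds ha), eventually_gt_atTop 0] with k hk hk0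
      have hk0 : (0 : ℝ) < k := by exact_mod_cast hk0
      have : (k : ℝ) + 1 = (1 + 1 / k) * k := by field_simp
      push_cast
      rw [this, mul_pow]
      gcongr
    · have := (hWmean.cesaro.comp hpow).add hω
      rw [add_zero] at this
      refine this.congr fun k ↦ ?_
      simp only [Function.comp]
      ring
  filter_upwards [hW, ae_eventually_truncateAbove_eq hint hB] with ω h1 h2
  have h3 : Tendsto (fun j ↦ X j ω ^ 2 - W j ω) atTop (𝓝 0) :=
    tendsto_const_nhds.congr' (by filter_upwards [h2] with j hj; simp [W, hj])
  have := h3.cesaro.add h1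
  rw [zero_add] at this
  refine this.congr fun n ↦ ?_
  rw [Finset.sum_sub_distrib]
  ring

/-! ### Complete convergence for Gaussian vectors -/

/-- Averages of i.i.d. variables with exponential moments converge completely to the mean. -/
lemma tsum_pi_measure_abs_sub_mean_ne_top {μ : Measure ℝ} [IsProbabilityMeasure μ] {f : ℝ → ℝ}
    (h0 : integrableExpSet f μ ∈ 𝓝 0) {δ : ℝ} (hδ : 0 < δ) :
    ∑' n : ℕ, (Measure.pi fun _ : Fin n ↦ μ)
      {g | δ ≤ |(∑ i, f (g i)) / n - ∫ x, f x ∂μ|} ≠ ⊤ := by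
  set m := ∫ x, f x ∂μ
  have h0' : integrableExpSet (-f) μ ∈ 𝓝 0 := by
    have : Tendsto (fun x : ℝ ↦ -x) (𝓝 0) (𝓝 0) := by simpa using (continuous_neg (G := ℝ)).tendsto 0
    filter_upwards [this h0] with s hs
    simpa [integrableExpSet] using hs
  obtain ⟨ρ₁, a1, b1, h1⟩ := exists_pi_measure_sum_ge_le_pow (mem_interior_iff_mem_nhds.2 h0)
    (show m < m + δ by linarith)
  obtain ⟨ρ₂, a2, b2, h2⟩ := exists_pi_measure_sum_ge_le_pow (mem_interior_iff_mem_nhds.2 h0')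
    (c := -m + δ) (by simp only [Pi.neg_apply, integral_neg]; linarith)
  have hb : ∀ n : ℕ, (Measure.pi fun _ : Fin n ↦ μ)
      {g | δ ≤ |(∑ i, f (g i)) / n - m|} ≤ ENNReal.ofReal (ρ₁ ^ n + ρ₂ ^ n) := by
    intro n
    rw [← ofReal_measureReal]
    refine ENNReal.ofReal_le_ofReal (le_trans ?_ (add_le_add (h1 n) (h2 n)))
    refine (measureReal_mono (fun g hg ↦ ?_)).trans (measureReal_union_le _ _)
    -- For `n = 0` the upper-tail event reads `0 ≤ 0` and is the whole space.
    rcases n.eq_zero_or_pos with rfl | hn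
    · left; simp
    have hn : (0 : ℝ) < n := by exact_mod_cast hn
    have hdiv : (n : ℝ) * ((∑ i, f (g i)) / n) = ∑ i, f (g i) := by field_simp
    rw [Set.mem_ofPred_eq] at hg
    rcases le_abs.1 hg with h | h
    · left
      simp only [Set.mem_ofPred_eq]
      nlinarith
    · right
      simp only [Set.mem_ofPred_eq, Pi.neg_apply, Finset.sum_neg_distrib]
      nlinarith
  refine ne_top_of_le_ne_top ?_ (ENNReal.tsum_le_tsum hb)
  exact ((summable_geometric_of_lt_one a1 b1).add
    (summable_geometric_of_lt_one a2 b2)).tsum_ofReal_ne_top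

lemma integrableExpSet_indicator_Iic_mem_nhds {μ : Measure ℝ} [IsProbabilityMeasure μ] (t : ℝ) :
    integrableExpSet ((Set.Iic t).indicator fun _ ↦ (1 : ℝ)) μ ∈ 𝓝 0 := by
  refine Filter.mem_of_superset Filter.univ_mem fun s _ ↦ ?_
  refine integrable_exp_mul_of_mem_Icc (a := 0) (b := 1)
    (measurable_const.indicator measurableSet_Iic).aemeasurable (ae_of_all _ fun x ↦ ?_)
  exact ⟨Set.indicator_nonneg (fun _ _ ↦ zero_le_one) _,
    Set.indicator_le_self' (fun _ _ ↦ zero_le_one) _⟩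

/-- Fernique's theorem supplies `C > 0` with `exp (C x²)` integrable, and this dominates every `s <
C`. -/
lemma integrableExpSet_sq_gaussianReal_mem_nhds :
    integrableExpSet (fun x : ℝ ↦ x ^ 2) (gaussianReal 0 1) ∈ 𝓝 0 := by
  obtain ⟨C, hC, hint⟩ := IsGaussian.exists_integrable_exp_sq (gaussianReal 0 1)
  filter_upwards [gt_mem_nhds hC] with s hs
  refine hint.mono' (by fun_prop) (ae_of_all _ fun x ↦ ?_)
  rw [Real.norm_of_nonneg (Real.exp_pos _).le, Real.norm_eq_abs, sq_abs]
  gcongr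

lemma integral_sq_gaussianReal : ∫ x, x ^ 2 ∂(gaussianReal 0 1) = 1 := by
  have h := variance_id_gaussianReal (μ := 0) (v := 1)
  rw [variance_of_integral_eq_zero aemeasurable_id (by simp)] at h
  simpa using h

lemma tsum_gaussian_empiricalCDF_ne_top (t : ℝ) {δ : ℝ} (hδ : 0 < δ) :
    ∑' n : ℕ, (Measure.pi fun _ : Fin n ↦ gaussianReal 0 1)
      {g | δ ≤ |empiricalCDF g t - stdNormalCDF t|} ≠ ⊤ := by
  have h := tsum_pi_measure_abs_sub_mean_ne_top
    (integrableExpSet_indicator_Iic_mem_nhds (μ := gaussianReal 0 1) t) hδ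
  rw [integral_indicator_const _ measurableSet_Iic, smul_eq_mul, mul_one, ← cdf_eq_real,
    ← stdNormalCDF_eq_cdf] at h
  simpa only [empiricalCDF, one_div_mul_eq_div] using h

lemma tsum_gaussian_sum_sq_ne_top {δ : ℝ} (hδ : 0 < δ) :
    ∑' n : ℕ, (Measure.pi fun _ : Fin n ↦ gaussianReal 0 1)
      {g | δ ≤ |(∑ i, g i ^ 2) / n - 1|} ≠ ⊤ := by
  have h := tsum_pi_measure_abs_sub_mean_ne_top integrableExpSet_sq_gaussianReal_mem_nhds hδ
  rwa [integral_sq_gaussianReal] at h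

lemma eq_sqrt_mul_sphereNormalize {n : ℕ} {y : Fin n → ℝ} (hy : 0 < (∑ j, y j ^ 2) / n)
    (k : Fin n) : y k = √((∑ j, y j ^ 2) / n) * sphereNormalize y k := by
  have hn : (0 : ℝ) < n := by exact_mod_cast k.pos
  have hs : 0 < ∑ j, y j ^ 2 := by
    have := mul_pos hy hn
    rwa [div_mul_cancel₀ _ hn.ne'] at this
  have h1 : √(n : ℝ) ≠ 0 := by positivity
  have h2 : √(∑ j, y j ^ 2) ≠ 0 := by positivity
  rw [sphereNormalize, Real.sqrt_div hs.le]
  field_simp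

/-- Moves the random length of `y` out of the sample and into the evaluation point. -/
lemma empiricalCDF_eq_sphereNormalize {n : ℕ} {y : Fin n → ℝ} (hy : 0 < (∑ j, y j ^ 2) / n)
    (x : ℝ) :
    empiricalCDF y x = empiricalCDF (sphereNormalize y) (x / √((∑ j, y j ^ 2) / n)) := by
  rw [← empiricalCDF_const_mul _ (Real.sqrt_pos.2 hy)]
  congr 1
  exact funext fun k ↦ eq_sqrt_mul_sphereNormalize hy k

/-- The empirical distribution functions of normalized Gaussian vectors converge completely. -/
lemma tsum_gaussian_empiricalCDF_sphereNormalize_ne_top (q : ℝ) {ε : ℝ} (hε : 0 < ε) :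
    ∑' n : ℕ, (Measure.pi fun _ : Fin n ↦ gaussianReal 0 1)
      {g | ε ≤ |empiricalCDF (sphereNormalize g) q - stdNormalCDF q|} ≠ ⊤ := by
  obtain ⟨δ, hδ, hΦ⟩ := Metric.continuous_iff.1 continuous_stdNormalCDF q (ε / 2) (by positivity)
  have hcont : Continuous fun y : ℝ ↦ √y * q := by fun_prop
  obtain ⟨η, hη, hr⟩ := Metric.continuous_iff.1 hcont 1 (δ / 2) (by positivity)
  -- The cap at 1 keeps the mean square positive, so that `g` can be recovered from its
  -- normalization.
  have hη' : 0 < min η 1 := by positivity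
  have h1 := tsum_gaussian_sum_sq_ne_top hη'
  have h2 := tsum_gaussian_empiricalCDF_ne_top (q - δ / 2) (half_pos hε)
  have h3 := tsum_gaussian_empiricalCDF_ne_top (q + δ / 2) (half_pos hε)
  have h := ENNReal.add_ne_top.2 ⟨ENNReal.add_ne_top.2 ⟨h1, h2⟩, h3⟩
  rw [← ENNReal.tsum_add, ← ENNReal.tsum_add] at h
  -- Off three summable events, the mean square is near 1 and the empirical CDF is near `Φ` at `q ±
  -- δ / 2`; these points bracket the rescaled point, and monotonicity concludes.
  refine ne_top_of_le_ne_top h (ENNReal.tsum_le_tsum fun n ↦ ?_)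
  refine (measure_mono fun g hg ↦ ?_).trans ((measure_union_le _ _).trans
    (add_le_add_left (measure_union_le _ _) _))
  by_contra hc
  simp only [Set.mem_union, Set.mem_ofPred_eq, not_or, not_le] at hc hg
  obtain ⟨⟨c1, c2⟩, c3⟩ := hc
  have hpos : 0 < (∑ i, g i ^ 2) / n := by
    have := (abs_lt.1 (c1.trans_le (min_le_right _ _))).1; linarith
  have hclose := hr _ (c1.trans_le (min_le_left _ _))
  rw [Real.dist_eq, Real.sqrt_one, one_mul, abs_lt] at hclose
  have hF : empiricalCDF (sphereNormalize g) q =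
      empiricalCDF g (√((∑ i, g i ^ 2) / n) * q) := by
    rw [empiricalCDF_eq_sphereNormalize hpos, mul_div_cancel_left₀ _ (Real.sqrt_pos.2 hpos).ne']
  have m1 := monotone_empiricalCDF g (show q - δ / 2 ≤ √((∑ i, g i ^ 2) / n) * q by linarith)
  have m2 := monotone_empiricalCDF g (show √((∑ i, g i ^ 2) / n) * q ≤ q + δ / 2 by linarith)
  have p1 := hΦ (q - δ / 2) (by rw [Real.dist_eq, abs_lt]; constructor <;> linarith)
  have p2 := hΦ (q + δ / 2) (by rw [Real.dist_eq, abs_lt]; constructor <;> linarith)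
  rw [Real.dist_eq, abs_lt] at p1 p2
  rw [abs_lt] at c2 c3
  rw [hF] at hg
  refine not_lt.2 hg (abs_lt.2 ⟨?_, ?_⟩) <;> linarith [c2.1, c3.2, p1.1, p2.2]

lemma measurable_empiricalCDF {n : ℕ} (x : ℝ) :
    Measurable fun s : Fin n → ℝ ↦ empiricalCDF s x := by
  unfold empiricalCDF
  refine (Finset.measurable_sum _ fun k _ ↦ ?_).const_mul _
  exact (measurable_const.indicator measurableSet_Iic).comp (measurable_pi_apply k)

/-! ### Random input vectors and the conclusion -/

/-- Away from the zero vector, a Haar rotation of an independent random vector is distributed,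
after normalization, as a normalized Gaussian vector. -/
lemma measure_sphereNormalize_mulVec_le {Ω : Type*} [MeasurableSpace Ω] {P : Measure Ω}
    [IsProbabilityMeasure P] {n : ℕ} {U : Ω → Matrix.orthogonalGroup (Fin n) ℝ}
    (hU : IsHaarDistributed P U) {Y : Ω → Fin n → ℝ} (hY : Measurable Y) (hUY : IndepFun U Y P)
    {A : Set (Fin n → ℝ)} (hA : MeasurableSet A) :
    P {ω | Y ω ≠ 0 ∧ sphereNormalize ((U ω : Matrix (Fin n) (Fin n) ℝ) *ᵥ Y ω) ∈ A} ≤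
      (Measure.pi fun _ : Fin n ↦ gaussianReal 0 1) {g | sphereNormalize g ∈ A} := by
  have hhaar := hU.2
  have hprob : IsProbabilityMeasure (P.map U) := Measure.isProbabilityMeasure_map hU.1.aemeasurable
  have hprob' : IsProbabilityMeasure (P.map Y) := Measure.isProbabilityMeasure_map hY.aemeasurable
  let S : Set (Matrix.orthogonalGroup (Fin n) ℝ × (Fin n → ℝ)) :=
    {p | p.2 ≠ 0 ∧ sphereNormalize ((p.1 : Matrix (Fin n) (Fin n) ℝ) *ᵥ p.2) ∈ A}
  have hS : MeasurableSet S :=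
    (measurable_snd (measurableSet_singleton (0 : Fin n → ℝ)).compl).inter
      ((measurable_sphereNormalize.comp measurable_mulVec_orthogonalGroup) hA)
  have h1 : P {ω | Y ω ≠ 0 ∧ sphereNormalize ((U ω : Matrix (Fin n) (Fin n) ℝ) *ᵥ Y ω) ∈ A} =
      ((P.map U).prod (P.map Y)) S := by
    rw [← (indepFun_iff_map_prod_eq_prod_map_map hU.1.aemeasurable hY.aemeasurable).1 hUY,
      Measure.map_apply (hU.1.prodMk hY) hS]
    rfl
  rw [h1, Measure.prod_apply_symm hS]
  set c := (Measure.pi fun _ : Fin n ↦ gaussianReal 0 1) {g | sphereNormalize g ∈ A}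
  calc _ ≤ ∫⁻ _, c ∂(P.map Y) := lintegral_mono fun y ↦ ?_
    _ = c := by simp
  by_cases hy : y = 0
  · refine (measure_mono_null (fun u hu ↦ ?_) measure_empty).trans_le zero_le
    exact hu.1 hy
  · refine (measure_mono fun u hu ↦ ?_).trans_eq
      (measure_sphereNormalize_mulVec_mem (P.map U) hy hA)
    exact hu.2

lemma ae_tendsto_empiricalCDF_sphereNormalize {Ω : Type*} [MeasurableSpace Ω] {P : Measure Ω}
    [IsProbabilityMeasure P] {U : (n : ℕ) → Ω → Matrix.orthogonalGroup (Fin n) ℝ}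
    (hU : ∀ n, IsHaarDistributed P (U n)) {Y : (n : ℕ) → Ω → Fin n → ℝ}
    (hY : ∀ n, Measurable (Y n)) (hUY : ∀ n, IndepFun (U n) (Y n) P)
    (hY0 : ∀ᵐ ω ∂P, ∀ᶠ n in atTop, Y n ω ≠ 0) (q : ℝ) :
    ∀ᵐ ω ∂P, Tendsto (fun n ↦ empiricalCDF
      (sphereNormalize ((U n ω : Matrix (Fin n) (Fin n) ℝ) *ᵥ Y n ω)) q) atTop
      (𝓝 (stdNormalCDF q)) := by
  classical
  -- Substituting the limit where `Y n ω = 0` confines the deviation events to nonzero vectors,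
  -- where the Gaussian comparison holds.
  have h : ∀ᵐ ω ∂P, Tendsto (fun n ↦ if Y n ω = 0 then stdNormalCDF q else empiricalCDF
      (sphereNormalize ((U n ω : Matrix (Fin n) (Fin n) ℝ) *ᵥ Y n ω)) q) atTop
      (𝓝 (stdNormalCDF q)) := by
    refine ae_tendsto_of_tsum_measure_ne_top fun ε hε ↦ ?_
    refine ne_top_of_le_ne_top (tsum_gaussian_empiricalCDF_sphereNormalize_ne_top q hε)
      (ENNReal.tsum_le_tsum fun n ↦ ?_)
    have hA : MeasurableSet {s : Fin n → ℝ | ε ≤ |empiricalCDF s q - stdNormalCDF q|} :=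
      measurableSet_le measurable_const ((measurable_empiricalCDF q).sub_const _).abs
    refine (measure_mono fun ω hω ↦ ?_).trans
      (measure_sphereNormalize_mulVec_le (hU n) (hY n) (hUY n) hA)
    simp only [Set.mem_ofPred_eq] at hω ⊢
    split_ifs at hω with h0
    · rw [sub_self, abs_zero] at hω; exact absurd hω (not_le.2 hε)
    · exact ⟨h0, hω⟩
  filter_upwards [h, hY0] with ω h1 h2
  refine h1.congr' ?_
  filter_upwards [h2] with n hn
  rw [if_neg hn]

theorem mainTheorem3 {Ω : Type*} [MeasurableSpace Ω] (P : Measure Ω) [IsProbabilityMeasure P]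
    (X : ℕ → Ω → ℝ) (hX : ∀ j, Measurable (X j)) (hindep : iIndepFun X P)
    (hmean : ∀ j, ∫ ω, X j ω ∂P = 0) (hvar : ∀ j, ∫ ω, X j ω ^ 2 ∂P = 1)
    (hthird : (⨆ j, ∫⁻ ω, ENNReal.ofReal (|X j ω| ^ 3) ∂P) < ⊤)
    (U : (n : ℕ) → Ω → Matrix.orthogonalGroup (Fin n) ℝ)
    (hU : ∀ n, IsHaarDistributed P (U n))
    (hUX : ∀ n, IndepFun (U n) (fun ω j => X j ω) P) :
    ∀ᵐ ω ∂P, Tendsto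
      (fun n : ℕ => ⨆ x : ℝ,
        |empiricalCDF (rowSum (U n ω) (fun j => X j ω)) x - stdNormalCDF x|)
      atTop (𝓝 0) := by
  have hle : ∀ j, ∫⁻ ω, ENNReal.ofReal (|X j ω| ^ 3) ∂P ≤
      ⨆ j, ∫⁻ ω, ENNReal.ofReal (|X j ω| ^ 3) ∂P := fun j ↦
    le_iSup (fun j ↦ ∫⁻ ω, ENNReal.ofReal (|X j ω| ^ 3) ∂P) j
  have hm3 : ∀ j, AEStronglyMeasurable (fun ω ↦ |X j ω| ^ 3) P := fun j ↦
    ((hX j).abs.pow_const 3).aestronglyMeasurable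
  have hint : ∀ j, Integrable (fun ω ↦ |X j ω| ^ 3) P := fun j ↦
    (lintegral_ofReal_ne_top_iff_integrable (hm3 j) (ae_of_all _ fun ω ↦ by positivity)).1
      ((hle j).trans_lt hthird).ne
  have hB : ∀ j, ∫ ω, |X j ω| ^ 3 ∂P ≤
      (⨆ j, ∫⁻ ω, ENNReal.ofReal (|X j ω| ^ 3) ∂P).toReal := fun j ↦ by
    rw [integral_eq_lintegral_of_nonneg_ae (ae_of_all _ fun ω ↦ by positivity) (hm3 j)]
    exact ENNReal.toReal_mono hthird.ne (hle j)
  have hS := ae_tendsto_sum_sq_div hX hindep hvar hint hB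
  let Y : (n : ℕ) → Ω → Fin n → ℝ := fun n ω j ↦ X j ω
  have hYS : ∀ n ω, ∑ j, Y n ω j ^ 2 = ∑ j ∈ Finset.range n, X j ω ^ 2 := fun n ω ↦
    Fin.sum_univ_eq_sum_range (fun j ↦ X j ω ^ 2) n
  have hY : ∀ n, Measurable (Y n) := fun n ↦ measurable_pi_lambda _ fun j ↦ hX j
  have hUY : ∀ n, IndepFun (U n) (Y n) P := fun n ↦
    (hUX n).comp measurable_id
      (measurable_pi_lambda (fun (x : ℕ → ℝ) (j : Fin n) ↦ x j) fun j ↦ measurable_pi_apply _)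
  have hpos : ∀ᵐ ω ∂P, ∀ᶠ n in atTop, 0 < (∑ j, Y n ω j ^ 2) / n := by
    filter_upwards [hS] with ω hω
    filter_upwards [hω.eventually (lt_mem_nhds one_pos)] with n hn
    rwa [hYS]
  have hY0 : ∀ᵐ ω ∂P, ∀ᶠ n in atTop, Y n ω ≠ 0 := by
    filter_upwards [hpos] with ω hω
    filter_upwards [hω] with n hn h0
    simp [h0] at hn
  have hq : ∀ᵐ ω ∂P, ∀ q : ℚ, Tendsto (fun n ↦ empiricalCDF
      (sphereNormalize ((U n ω : Matrix (Fin n) (Fin n) ℝ) *ᵥ Y n ω)) (q : ℝ)) atTop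
      (𝓝 (stdNormalCDF q)) :=
    ae_all_iff.2 fun q ↦ ae_tendsto_empiricalCDF_sphereNormalize hU hY hUY hY0 q
  filter_upwards [hS, hpos, hq] with ω h1 h2 h3
  refine tendsto_iSup_abs_sub_stdNormalCDF (fun n ↦ monotone_empiricalCDF _)
    (fun n ↦ empiricalCDF_nonneg _) (fun n ↦ empiricalCDF_le_one _) fun x ↦ ?_
  -- Evaluating the raw sample at `x` means evaluating the normalized one at this moving point,
  -- which tends to `x` by the strong law.
  have ht : Tendsto (fun n : ℕ ↦ x / √((∑ j ∈ Finset.range n, X j ω ^ 2) / n)) atTop (𝓝 x) := by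
    have := Tendsto.div (tendsto_const_nhds (x := x)) h1.sqrt (by simp)
    rwa [Real.sqrt_one, div_one] at this
  have hlim := tendsto_apply_of_monotone_of_dense Rat.denseRange_cast
    (fun n ↦ monotone_empiricalCDF
      (sphereNormalize ((U n ω : Matrix (Fin n) (Fin n) ℝ) *ᵥ Y n ω)))
    continuous_stdNormalCDF (by rintro _ ⟨q, rfl⟩; exact h3 q) ht
  refine hlim.congr' ?_
  filter_upwards [h2] with n hn
  have hrow : rowSum (U n ω) (fun j ↦ X j ω) = (U n ω : Matrix (Fin n) (Fin n) ℝ) *ᵥ Y n ω := rfl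
  rw [hrow, empiricalCDF_eq_sphereNormalize
    (y := (U n ω : Matrix (Fin n) (Fin n) ℝ) *ᵥ Y n ω) (by rwa [sum_sq_mulVec]), sum_sq_mulVec, hYS]
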